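/- All graphs are finite and simple. An edge $k$-colouring of a graph assigns to each edge a colour in $\{1,\dots,k\}$ so that adjacent edges get distinct colours, and $\chi'$ denotes the chromatic index. Let $G$ be a graph with maximum degree $\Delta$ that is $\Delta$-critical, i.e. $\chi'(G)=\Delta+1$ and $\chi'(H)<\chi'(G)$ for every proper subgraph $H$ of $G$. Let $\varepsilon\in(0,1)$, let $q=(1-\varepsilon)\Delta$, let $xy\in E(G)$ with $d(x)<\varepsilon\Delta$, and let $\varphi$ be an edge $\Delta$-colouring of $G-xy$. Degrees $d(\cdot)$ and neighbourhoods $N(\cdot)$ are taken in $G$; the edge $xy$ has no colour. For a vertex $v$ let $\varphi(v)$ be the set of colours of the edges of $G-xy$ at $v$, and let $\overline\varphi(v)=\{1,\dots,\Delta\}\setminus\varphi(v)$. Put $$A_\varphi=\{\alpha\in\varphi(x): \exists\, u\in N(y),\ \varphi(yu)=\alpha,\ d(u)<q\},$$ $$B_\varphi=\{\beta\in\varphi(x): \exists\, u\in N(y),\ \varphi(yu)=\beta,\ d(u)\ge q\},$$ $$M_\varphi=A_\varphi\cup\overline\varphi(x)\cup\overline\varphi(y),$$ and for a set $C$ of colours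 let $N(x,C)=\{z\in N(x)\setminus\{y\}:\varphi(xz)\in C\}$. For a vertex $v$ let $\overline\varphi_{s}(v)$ (the "small" set of $v$) be the set of colours $\alpha\in\{1,\dots,\Delta\}$ such that $\alpha\in\overline\varphi(v)$ or $\varphi(vv')=\alpha$ for some $v'\in N(v)$ with $d(v')<q$. (1) Let $z\in N(x,M_\varphi)$, let $\beta\in\overline\varphi_{s}(z)\cap B_\varphi$, and let $w\in N(x,B_\varphi)$ be the neighbour of $x$ with $\varphi(xw)=\beta$. Put $$B_w(\varphi)=\{\varphi(ww') : w'\in N(w),\ \varphi(ww')\in B_\varphi\setminus\{\beta\},\ d(w')<q\}.$$ Then for every $\beta'\in B_w(\varphi)$ there exist $z'\in N(x,B_\varphi)$ and $u\in N(z')$ such that $\varphi(xz')=\beta'$, $\varphi(z'u)=\beta$ and $d(u)\ge q$. (2) If $\bigl(\bigcup_{z\in N(x,M_\varphi)}\overline\varphi_{s}(z)\bigr)\cap B_\varphi=B_\varphi$ and $|B_\varphi|=2$, then there is $z'\in N(x,B_\varphi)$ such that $d(u)\ge q$ for every $u\in N(z')\setminus\{x\}$. -/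

import Mathlib

namespace EdgeCritical

/-- `φ` is an edge `k`-colouring of `H`: it assigns to every edge of `H` a colour in `{1, …, k}` so
that distinct edges with a common endpoint get distinct colours. The values of `φ` outside the edge
set of `H` carry no meaning, and every notion below only reads `φ` on edges of `H`. -/
def IsEdgeColoring {V : Type*} (H : SimpleGraph V) (k : ℕ) (φ : Sym2 V → ℕ) : Prop :=
  (∀ e ∈ H.edgeSet, φ e ∈ Set.Icc 1 k) ∧
    ∀ v u w : V, H.Adj v u → H.Adj v w → u ≠ w → φ s(v, u) ≠ φ s(v, w)

/-- The chromatic index: the least `k` such that `H` has an edge `k`-colouring. -/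
noncomputable def chromaticIndex {V : Type*} (H : SimpleGraph V) : ℕ :=
  sInf {k : ℕ | ∃ φ : Sym2 V → ℕ, IsEdgeColoring H k φ}

/-- For a finite graph the set in the definition of the chromatic index is non-empty, so the
chromatic index is attained by a colouring. -/
theorem exists_isEdgeColoring_chromaticIndex {V : Type*} [Finite V] (H : SimpleGraph V) :
    ∃ φ : Sym2 V → ℕ, IsEdgeColoring H (chromaticIndex H) φ := by
  have hne : {k : ℕ | ∃ φ : Sym2 V → ℕ, IsEdgeColoring H k φ}.Nonempty := by
    obtain ⟨n, ⟨f⟩⟩ := Finite.exists_equiv_fin (Sym2 V)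
    refine ⟨n, fun e => (f e : ℕ) + 1, fun e _ => ?_, ?_⟩
    · have := (f e).isLt
      simp only [Set.mem_Icc]
      omega
    · intro v u w _ _ huw h
      apply huw
      have h2 : s(v, u) = s(v, w) := f.injective (Fin.ext (by simpa using h))
      exact Sym2.congr_right.mp h2
  exact Nat.sInf_mem hne

/-- `G` is `Δ`-critical, where `Δ` is its maximum degree: `χ'(G) = Δ + 1`, and every proper subgraph
of `G` has a smaller chromatic index than `G`. -/
def IsDeltaCritical {V : Type*} [Fintype V] (G : SimpleGraph V) [DecidableRel G.Adj] : Prop :=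
  chromaticIndex G = G.maxDegree + 1 ∧
    ∀ H : G.Subgraph, H ≠ ⊤ → chromaticIndex H.coe < chromaticIndex G

/-- `G - xy`. -/
def minusEdge {V : Type*} (G : SimpleGraph V) (x y : V) : SimpleGraph V :=
  G.deleteEdges {s(x, y)}

/-- `φ(v)`: the colours present at `v`, where `φ` is an edge colouring of `H`. -/
def present {V : Type*} (H : SimpleGraph V) (φ : Sym2 V → ℕ) (v : V) : Set ℕ :=
  {α | ∃ u, H.Adj v u ∧ φ s(v, u) = α}

/-- The colours of `{1, …, k}` missing at `v`, where `φ` is an edge `k`-colouring of `H`. -/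
def missing {V : Type*} (H : SimpleGraph V) (k : ℕ) (φ : Sym2 V → ℕ) (v : V) : Set ℕ :=
  Set.Icc 1 k \ present H φ v

section

variable {V : Type*} [Fintype V] (G : SimpleGraph V) [DecidableRel G.Adj]

/-- `A_φ(x, y, q)`, for an edge `Δ`-colouring `φ` of `G - xy`. Degrees are taken in `G`. -/
def setA (φ : Sym2 V → ℕ) (x y : V) (q : ℝ) : Set ℕ :=
  {α | α ∈ present (minusEdge G x y) φ x ∧
    ∃ u, (minusEdge G x y).Adj y u ∧ φ s(y, u) = α ∧ (G.degree u : ℝ) < q}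

/-- `B_φ(x, y, q)`. -/
def setB (φ : Sym2 V → ℕ) (x y : V) (q : ℝ) : Set ℕ :=
  {β | β ∈ present (minusEdge G x y) φ x ∧
    ∃ u, (minusEdge G x y).Adj y u ∧ φ s(y, u) = β ∧ q ≤ (G.degree u : ℝ)}

/-- `M_φ(x, y, q)`: the union of `A_φ(x, y, q)` and the sets of colours missing at `x` and at `y`. -/
def setM (φ : Sym2 V → ℕ) (x y : V) (q : ℝ) : Set ℕ :=
  setA G φ x y q ∪ missing (minusEdge G x y) G.maxDegree φ x ∪
    missing (minusEdge G x y) G.maxDegree φ y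

/-- `N(x, C)` for a set `C` of colours: the neighbours `z` of `x` such that the edge `xz` is coloured
with a colour in `C`. The uncoloured neighbour `y` does not belong to it. -/
def nbr (φ : Sym2 V → ℕ) (x y : V) (C : Set ℕ) : Set V :=
  {z | (minusEdge G x y).Adj x z ∧ φ s(x, z) ∈ C}

/-- The "small" set of `v`: the colours of `{1, …, Δ}` which are missing at `v` or are the colour of
an edge `vv'` with `d(v') < q`. -/
def smallSet (φ : Sym2 V → ℕ) (x y : V) (q : ℝ) (v : V) : Set ℕ :=
  {α | α ∈ Set.Icc 1 G.maxDegree ∧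
    (α ∈ missing (minusEdge G x y) G.maxDegree φ v ∨
      ∃ v', (minusEdge G x y).Adj v v' ∧ φ s(v, v') = α ∧ (G.degree v' : ℝ) < q)}

/-- `B_w(φ)` relative to `β`: the colours in `B_φ(x, y, q) - {β}` of edges `ww'` with `d(w') < q`. -/
def setBw (φ : Sym2 V → ℕ) (x y : V) (q : ℝ) (β : ℕ) (w : V) : Set ℕ :=
  {γ | ∃ w', (minusEdge G x y).Adj w w' ∧ φ s(w, w') = γ ∧ γ ∈ setB G φ x y q \ {β} ∧
    (G.degree w' : ℝ) < q}

end

end EdgeCritical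

namespace EdgeCritical

variable {V : Type*}

/-! Since `d(u) < q` and `d(x) < εΔ` give `d(u) + d(x) < Δ`, every vertex `u` of degree below `q` is
`Light`: it shares a missing colour with `x`. Criticality enters only through the fact that `G` has
no edge `Δ`-colouring. Hence `x` and `y` share no missing colour, and a Kempe chain on a colour
missing at `x` and one missing at `y` joins `x` to `y`. A third vertex missing one of these colours
lies on another chain, which can be swapped without disturbing `x` or `y`.

Such swaps free at `y` any colour `α` that sits on an edge from `y` to a light vertex
(`exists_free_color`). If `xz` has colour `α`, then `xy` can take `α` and `xz` become the uncoloured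
edge, with almost all other colours preserved (`exists_dual`). Thus "missing or leading to a light
vertex" behaves much like "missing", and the move can be iterated.

For (1), the uncoloured edge is moved from `xy` to `xz` and on to `xw`. Now `β` is missing at `w`,
and the colour `β'` of `xz'` is small at `w`, so `β` cannot be small at `z'`
(`not_isSmallColor_of_chain`); its edge at `z'` therefore ends in a vertex of degree at least `q`.

For (2), the same moves show that an edge from `w` to a vertex other than `x` of degree below `q`
has its colour in `B` (`mem_setB_of_degree_lt`). If (2) failed for `B = {β₁, β₂}`, the ends of the
`β₁`- and `β₂`-edges at `x` would have such edges coloured `β₂` and `β₁` respectively, against (1).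
-/

theorem minusEdge_adj {G : SimpleGraph V} {x y a b : V} :
    (minusEdge G x y).Adj a b ↔ G.Adj a b ∧ s(a, b) ≠ s(x, y) := by
  simp [minusEdge, SimpleGraph.deleteEdges_adj]

theorem minusEdge_comm (G : SimpleGraph V) (x y : V) : minusEdge G x y = minusEdge G y x := by
  unfold minusEdge; rw [Sym2.eq_swap]

theorem mem_missing {H : SimpleGraph V} {k : ℕ} {φ : Sym2 V → ℕ} {v : V} {c : ℕ} :
    c ∈ missing H k φ v ↔ c ∈ Set.Icc 1 k ∧ ∀ u, H.Adj v u → φ s(v, u) ≠ c := by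
  simp [missing, present]

/-- The colour `c` is missing at `v` or it is the colour of an edge joining `v` to a vertex
satisfying `P`. -/
def IsSmallColor (H : SimpleGraph V) (k : ℕ) (φ : Sym2 V → ℕ) (P : V → Prop) (v : V) (c : ℕ) :
    Prop :=
  c ∈ missing H k φ v ∨ ∃ u, H.Adj v u ∧ φ s(v, u) = c ∧ P u

/-- The degree of `u` is so small that, in a `k`-colouring, `u` and `x` share missing colours. -/
def Light [Fintype V] (G : SimpleGraph V) [DecidableRel G.Adj] (k : ℕ) (x u : V) : Prop :=
  G.degree u + G.degree x < k

/-- The subgraph formed by the edges of `H` coloured `a` or `b`. -/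
def kempeGraph (H : SimpleGraph V) (φ : Sym2 V → ℕ) (a b : ℕ) : SimpleGraph V where
  Adj u v := H.Adj u v ∧ (φ s(u, v) = a ∨ φ s(u, v) = b)
  symm := ⟨fun u v h => by rwa [SimpleGraph.adj_comm, Sym2.eq_swap]⟩
  loopless := ⟨fun u h => H.loopless.irrefl u h.1⟩

/-! ### Paths in graphs of maximum degree two -/

/-- Having come from `p`, a path has only one way to continue at each vertex, and it can stop at a
leaf only; so both paths follow the same route. -/
theorem eq_of_isPath_of_isPath {K : SimpleGraph V}
    (h2 : ∀ v a b c, K.Adj v a → K.Adj v b → K.Adj v c → a = b ∨ a = c ∨ b = c) {a b c p : V}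
    (hb : ∀ s t, K.Adj b s → K.Adj b t → s = t) (hc : ∀ s t, K.Adj c s → K.Adj c t → s = t)
    (P : K.Walk a b) (Q : K.Walk a c) (hP : P.IsPath) (hQ : Q.IsPath) (hpa : K.Adj a p)
    (hpP : p ∉ P.support) (hpQ : p ∉ Q.support) : b = c := by
  induction P generalizing p with
  | nil =>
    cases Q with
    | nil => rfl
    | cons h q =>
      have := hb _ _ hpa h
      subst this
      simp at hpQ
  | cons h P' ih =>
    cases Q with
    | nil =>
      have := hc _ _ hpa h
      subst this
      simp at hpP
    | cons h' Q' =>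
      rw [SimpleGraph.Walk.cons_isPath_iff] at hP hQ
      rcases h2 _ _ _ _ hpa h h' with e | e | e
      · subst e; simp at hpP
      · subst e; simp at hpQ
      · subst e
        exact ih hb Q' hP.1 hQ.1 h.symm hP.2 hQ.2

theorem eq_of_reachable_of_leaf {K : SimpleGraph V}
    (h2 : ∀ v a b c, K.Adj v a → K.Adj v b → K.Adj v c → a = b ∨ a = c ∨ b = c) {a b c : V}
    (ha : ∀ s t, K.Adj a s → K.Adj a t → s = t)
    (hb : ∀ s t, K.Adj b s → K.Adj b t → s = t) (hc : ∀ s t, K.Adj c s → K.Adj c t → s = t)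
    (hab : K.Reachable a b) (hac : K.Reachable a c) (hnab : a ≠ b) (hnac : a ≠ c) : b = c := by
  obtain ⟨P, hP⟩ := hab.exists_isPath
  obtain ⟨Q, hQ⟩ := hac.exists_isPath
  cases P with
  | nil => exact absurd rfl hnab
  | cons h P' =>
    cases Q with
    | nil => exact absurd rfl hnac
    | cons h' Q' =>
      have e := ha _ _ h h'
      subst e
      rw [SimpleGraph.Walk.cons_isPath_iff] at hP hQ
      exact eq_of_isPath_of_isPath h2 hb hc P' Q' hP.1 hQ.1 h.symm hP.2 hQ.2

/-! ### Recolouring an edge and swapping Kempe chains -/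

theorem IsEdgeColoring.inj {H : SimpleGraph V} {k : ℕ} {φ : Sym2 V → ℕ}
    (hφ : IsEdgeColoring H k φ) {v u w : V} (hu : H.Adj v u) (hw : H.Adj v w)
    (h : φ s(v, u) = φ s(v, w)) : u = w := by
  by_contra hne
  exact hφ.2 v u w hu hw hne h

theorem IsEdgeColoring.mono {H H' : SimpleGraph V} {k : ℕ} {φ : Sym2 V → ℕ}
    (hφ : IsEdgeColoring H k φ) (h : H' ≤ H) : IsEdgeColoring H' k φ :=
  ⟨fun e he => hφ.1 e (SimpleGraph.edgeSet_mono h he),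
    fun v u w hu hw => hφ.2 v u w (h hu) (h hw)⟩

theorem IsEdgeColoring.mem_Icc {H : SimpleGraph V} {k : ℕ} {φ : Sym2 V → ℕ}
    (hφ : IsEdgeColoring H k φ) {v u : V} (hu : H.Adj v u) : φ s(v, u) ∈ Set.Icc 1 k :=
  hφ.1 _ hu

open Classical in
theorem IsEdgeColoring.update {H : SimpleGraph V} {k : ℕ} {φ : Sym2 V → ℕ} {x y : V} {c : ℕ}
    (hφ : IsEdgeColoring (minusEdge H x y) k φ) (hc : c ∈ Set.Icc 1 k)
    (hx : ∀ v, H.Adj x v → v ≠ y → φ s(x, v) ≠ c) (hy : ∀ v, H.Adj y v → v ≠ x → φ s(y, v) ≠ c) :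
    IsEdgeColoring H k (Function.update φ s(x, y) c) := by
  have key : ∀ v u w : V, H.Adj v w → u ≠ w → s(v, u) = s(x, y) → φ s(v, w) ≠ c := by
    intro v u w hw hne he
    rcases Sym2.eq_iff.mp he with ⟨rfl, rfl⟩ | ⟨rfl, rfl⟩
    · exact hx _ hw hne.symm
    · exact hy _ hw hne.symm
  constructor
  · intro e he
    by_cases h : e = s(x, y)
    · rw [h, Function.update_self]; exact hc
    · rw [Function.update_of_ne h]
      refine hφ.1 e ?_
      simp only [minusEdge, SimpleGraph.edgeSet_deleteEdges]
      exact ⟨he, h⟩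
  · intro v u w hu hw hne
    by_cases h : s(v, u) = s(x, y)
    · have h' : s(v, w) ≠ s(x, y) := fun h' => hne (Sym2.congr_right.mp (h.trans h'.symm))
      rw [h, Function.update_self, Function.update_of_ne h']
      exact (key v u w hw hne h).symm
    · by_cases h' : s(v, w) = s(x, y)
      · rw [h', Function.update_self, Function.update_of_ne h]
        exact key v w u hu hne.symm h'
      · rw [Function.update_of_ne h, Function.update_of_ne h']
        exact hφ.2 v u w (minusEdge_adj.mpr ⟨hu, h⟩) (minusEdge_adj.mpr ⟨hw, h'⟩) hne

open Classical in
theorem exists_kempe_swap {H : SimpleGraph V} {k : ℕ} {φ : Sym2 V → ℕ}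
    (hφ : IsEdgeColoring H k φ) {a b : ℕ} (ha : a ∈ Set.Icc 1 k) (hb : b ∈ Set.Icc 1 k) (t : V) :
    ∃ ψ, IsEdgeColoring H k ψ ∧
      (∀ v u, H.Adj v u → (kempeGraph H φ a b).Reachable t v →
        ψ s(v, u) = Equiv.swap a b (φ s(v, u))) ∧
      ∀ v u, H.Adj v u → ¬ (kempeGraph H φ a b).Reachable t v → ψ s(v, u) = φ s(v, u) := by
  set R := (kempeGraph H φ a b).Reachable t with hR
  let ψ : Sym2 V → ℕ := fun e => if ∃ v ∈ e, R v then Equiv.swap a b (φ e) else φ e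
  have h1 : ∀ v u, H.Adj v u → R v → ψ s(v, u) = Equiv.swap a b (φ s(v, u)) := by
    intro v u _ hv
    exact if_pos ⟨v, by simp, hv⟩
  have h2 : ∀ v u, H.Adj v u → ¬ R v → ψ s(v, u) = φ s(v, u) := by
    intro v u hvu hv
    by_cases hu : R u
    -- An edge leaving the component has neither colour, so the swap fixes its colour.
    · have hne : ¬ (φ s(v, u) = a ∨ φ s(v, u) = b) := fun h =>
        hv (hu.trans (SimpleGraph.Adj.reachable (G := kempeGraph H φ a b) ⟨hvu, h⟩).symm)
      rw [not_or] at hne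
      have : ψ s(v, u) = Equiv.swap a b (φ s(v, u)) := if_pos ⟨u, by simp, hu⟩
      rw [this, Equiv.swap_apply_of_ne_of_ne hne.1 hne.2]
    · refine if_neg ?_
      rintro ⟨w, hw, hRw⟩
      rcases Sym2.mem_iff.mp hw with rfl | rfl
      · exact hv hRw
      · exact hu hRw
  refine ⟨ψ, ⟨?_, ?_⟩, h1, h2⟩
  · intro e
    induction e with
    | _ v u =>
      intro he
      have hm := hφ.mem_Icc he
      by_cases hv : R v
      · rw [h1 v u he hv, Equiv.swap_apply_def]
        split_ifs <;> assumption
      · rw [h2 v u he hv]; exact hm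
  · intro v u w hu hw hne
    by_cases hv : R v
    · rw [h1 v u hu hv, h1 v w hw hv]
      exact fun h => hφ.2 v u w hu hw hne ((Equiv.swap a b).injective h)
    · rw [h2 v u hu hv, h2 v w hw hv]
      exact hφ.2 v u w hu hw hne

theorem kempeGraph_adj_le_two {H : SimpleGraph V} {k : ℕ} {φ : Sym2 V → ℕ}
    (hφ : IsEdgeColoring H k φ) (a b : ℕ) (v p q r : V) (hp : (kempeGraph H φ a b).Adj v p)
    (hq : (kempeGraph H φ a b).Adj v q) (hr : (kempeGraph H φ a b).Adj v r) :
    p = q ∨ p = r ∨ q = r := by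
  have := @IsEdgeColoring.inj _ _ _ _ hφ v p q hp.1 hq.1
  have := @IsEdgeColoring.inj _ _ _ _ hφ v p r hp.1 hr.1
  have := @IsEdgeColoring.inj _ _ _ _ hφ v q r hq.1 hr.1
  have := hp.2
  have := hq.2
  have := hr.2
  grind

theorem kempeGraph_leaf {H : SimpleGraph V} {k : ℕ} {φ : Sym2 V → ℕ}
    (hφ : IsEdgeColoring H k φ) {a b : ℕ} {v : V}
    (hv : a ∈ missing H k φ v ∨ b ∈ missing H k φ v) (p q : V)
    (hp : (kempeGraph H φ a b).Adj v p) (hq : (kempeGraph H φ a b).Adj v q) : p = q := by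
  refine hφ.inj hp.1 hq.1 ?_
  simp only [mem_missing] at hv
  rcases hv with hv | hv
  · rw [hp.2.resolve_left (hv.2 _ hp.1), hq.2.resolve_left (hv.2 _ hq.1)]
  · rw [hp.2.resolve_right (hv.2 _ hp.1), hq.2.resolve_right (hv.2 _ hq.1)]

/-! ### Counting missing colours -/

section Missing

variable [Fintype V] {G : SimpleGraph V} [DecidableRel G.Adj] {k : ℕ} {x y : V}

theorem exists_mem_missing (φ : Sym2 V → ℕ) (hxy : G.Adj x y) (hd : G.degree x ≤ k) :
    ∃ c, c ∈ missing (minusEdge G x y) k φ x := by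
  classical
  by_contra! h
  have hsub : Finset.Icc 1 k ⊆ ((G.neighborFinset x).erase y).image (fun v => φ s(x, v)) := by
    intro c hc
    have := h c
    rw [mem_missing] at this
    push Not at this
    obtain ⟨u, hu, hc⟩ := this (by simpa using hc)
    rw [minusEdge_adj] at hu
    refine Finset.mem_image.mpr ⟨u, ?_, hc⟩
    simp only [Finset.mem_erase, SimpleGraph.mem_neighborFinset]
    exact ⟨fun e => hu.2 (by rw [e]), hu.1⟩
  have h1 := (Finset.card_le_card hsub).trans Finset.card_image_le
  rw [Finset.card_erase_of_mem (by simpa using hxy), Nat.card_Icc,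
    SimpleGraph.card_neighborFinset_eq_degree] at h1
  have h2 : 0 < G.degree x := (G.degree_pos_iff_exists_adj x).mpr ⟨y, hxy⟩
  omega

/-- As `xy` is uncoloured, `x` sees at most `d(x) - 1` colours; this spare unit pays for avoiding
`c₀`. -/
theorem exists_common_missing (φ : Sym2 V → ℕ) (hxy : G.Adj x y) {u : V} (hu : Light G k x u)
    (c₀ : ℕ) : ∃ c, c ≠ c₀ ∧ c ∈ missing (minusEdge G x y) k φ x ∧
      c ∈ missing (minusEdge G x y) k φ u := by
  classical
  by_contra! h
  have hsub : Finset.Icc 1 k ⊆ insert c₀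
      (((G.neighborFinset x).erase y).image (fun v => φ s(x, v)) ∪
        (G.neighborFinset u).image (fun v => φ s(u, v))) := by
    intro c hc
    rw [Finset.mem_insert, Finset.mem_union]
    by_contra! hn
    have hcI : c ∈ Set.Icc 1 k := by simpa using hc
    refine h c hn.1 (mem_missing.mpr ⟨hcI, fun v hv e => hn.2.1 ?_⟩)
      (mem_missing.mpr ⟨hcI, fun v hv e => hn.2.2 ?_⟩)
    · rw [minusEdge_adj] at hv
      refine Finset.mem_image.mpr ⟨v, ?_, e⟩
      simp only [Finset.mem_erase, SimpleGraph.mem_neighborFinset]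
      exact ⟨fun e => hv.2 (by rw [e]), hv.1⟩
    · rw [minusEdge_adj] at hv
      exact Finset.mem_image.mpr ⟨v, by simpa using hv.1, e⟩
  have h1 := (Finset.card_le_card hsub).trans ((Finset.card_insert_le _ _).trans
    (Nat.add_le_add_right ((Finset.card_union_le _ _).trans
      (Nat.add_le_add Finset.card_image_le Finset.card_image_le)) 1))
  rw [Finset.card_erase_of_mem (by simpa using hxy), Nat.card_Icc,
    SimpleGraph.card_neighborFinset_eq_degree, SimpleGraph.card_neighborFinset_eq_degree] at h1
  have h2 : 0 < G.degree x := (G.degree_pos_iff_exists_adj x).mpr ⟨y, hxy⟩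
  unfold Light at hu
  omega

end Missing

theorem minusEdge_adj_left {G : SimpleGraph V} {x y v : V} :
    (minusEdge G x y).Adj x v ↔ G.Adj x v ∧ v ≠ y := by
  rw [minusEdge_adj, ne_eq, Sym2.congr_right]

theorem minusEdge_adj_right {G : SimpleGraph V} {x y v : V} :
    (minusEdge G x y).Adj y v ↔ G.Adj y v ∧ v ≠ x := by
  rw [minusEdge_comm, minusEdge_adj_left]

theorem minusEdge_adj_of_ne {G : SimpleGraph V} {x y a b : V} (hx : a ≠ x) (hy : a ≠ y) :
    (minusEdge G x y).Adj a b ↔ G.Adj a b := by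
  rw [minusEdge_adj]
  refine and_iff_left fun e => ?_
  rcases Sym2.eq_iff.mp e with h | h
  · exact hx h.1
  · exact hy h.1

theorem mem_missing_congr {H H' : SimpleGraph V} {k : ℕ} {φ ψ : Sym2 V → ℕ} {v : V} {c : ℕ}
    (h : ∀ u, (H'.Adj v u ∧ ψ s(v, u) = c) ↔ (H.Adj v u ∧ φ s(v, u) = c)) :
    c ∈ missing H' k ψ v ↔ c ∈ missing H k φ v := by
  simp only [mem_missing]
  have : (∀ u, H'.Adj v u → ψ s(v, u) ≠ c) ↔ (∀ u, H.Adj v u → φ s(v, u) ≠ c) :=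
    forall_congr' fun u => by have := h u; tauto
  rw [this]

theorem isSmallColor_congr {H H' : SimpleGraph V} {k : ℕ} {φ ψ : Sym2 V → ℕ} {P : V → Prop}
    {v : V} {c : ℕ} (h : ∀ u, (H'.Adj v u ∧ ψ s(v, u) = c) ↔ (H.Adj v u ∧ φ s(v, u) = c)) :
    IsSmallColor H' k ψ P v c ↔ IsSmallColor H k φ P v c := by
  unfold IsSmallColor
  rw [mem_missing_congr h]
  refine or_congr Iff.rfl (exists_congr fun u => ?_)
  rw [← and_assoc, ← and_assoc, h u]

/-! ### Kempe chains between the ends of the uncoloured edge -/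

section

variable {G : SimpleGraph V} {k : ℕ} {φ : Sym2 V → ℕ} {x y : V}

theorem notMem_missing_of_mem_missing (hG : ∀ ψ, ¬ IsEdgeColoring G k ψ)
    (hφ : IsEdgeColoring (minusEdge G x y) k φ) {c : ℕ}
    (hx : c ∈ missing (minusEdge G x y) k φ x) : c ∉ missing (minusEdge G x y) k φ y := by
  classical
  intro hy
  rw [mem_missing] at hx hy
  exact hG _ (hφ.update hx.1 (fun v hv hne => hx.2 v (minusEdge_adj_left.mpr ⟨hv, hne⟩))
    fun v hv hne => hy.2 v (minusEdge_adj_right.mpr ⟨hv, hne⟩))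

/-- Otherwise swapping the chain at `y` would make `η` missing at both ends of `xy`. -/
theorem kempeGraph_reachable (hG : ∀ ψ, ¬ IsEdgeColoring G k ψ)
    (hφ : IsEdgeColoring (minusEdge G x y) k φ) {δ η : ℕ}
    (hη : η ∈ missing (minusEdge G x y) k φ x) (hδ : δ ∈ missing (minusEdge G x y) k φ y) :
    (kempeGraph (minusEdge G x y) φ δ η).Reachable x y := by
  by_contra hxy
  have hη' := mem_missing.mp hη
  have hδ' := mem_missing.mp hδ
  obtain ⟨ψ, hψ, h1, h2⟩ := exists_kempe_swap hφ hδ'.1 hη'.1 y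
  refine notMem_missing_of_mem_missing hG hψ (c := η) (mem_missing.mpr ⟨hη'.1, fun u hu => ?_⟩)
    (mem_missing.mpr ⟨hη'.1, fun u hu => ?_⟩)
  · rw [h2 x u hu fun h => hxy h.symm]
    exact hη'.2 u hu
  · rw [h1 y u hu (SimpleGraph.Reachable.refl y)]
    intro e
    refine hδ'.2 u hu ?_
    rw [← (Equiv.swap δ η).injective.eq_iff, e, Equiv.swap_apply_left]

/-- Swapping `δ` and `η` on the Kempe chain ending at a third vertex `t` does not affect `x`, `y`. -/
theorem exists_swap_at (hG : ∀ ψ, ¬ IsEdgeColoring G k ψ) (hxy : x ≠ y)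
    (hφ : IsEdgeColoring (minusEdge G x y) k φ) {δ η : ℕ}
    (hη : η ∈ missing (minusEdge G x y) k φ x) (hδ : δ ∈ missing (minusEdge G x y) k φ y)
    {t : V} (htx : t ≠ x) (hty : t ≠ y)
    (ht : δ ∈ missing (minusEdge G x y) k φ t ∨ η ∈ missing (minusEdge G x y) k φ t) :
    ∃ ψ, IsEdgeColoring (minusEdge G x y) k ψ ∧
      (∀ v, (minusEdge G x y).Adj x v → ψ s(x, v) = φ s(x, v)) ∧
      (∀ v, (minusEdge G x y).Adj y v → ψ s(y, v) = φ s(y, v)) ∧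
      (∀ v, (minusEdge G x y).Adj t v → ψ s(t, v) = Equiv.swap δ η (φ s(t, v))) ∧
      ∀ a b, (minusEdge G x y).Adj a b → ∀ c, c ≠ δ → c ≠ η →
        (ψ s(a, b) = c ↔ φ s(a, b) = c) := by
  have hr := kempeGraph_reachable hG hφ hη hδ
  have hlx := @kempeGraph_leaf _ _ _ _ hφ δ η x (Or.inr hη)
  have hly := @kempeGraph_leaf _ _ _ _ hφ δ η y (Or.inl hδ)
  have hlt := @kempeGraph_leaf _ _ _ _ hφ δ η t ht
  -- A component of maximum degree two cannot contain three distinct vertices of degree at most one.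
  have hx : ¬ (kempeGraph (minusEdge G x y) φ δ η).Reachable t x := fun h =>
    hty (eq_of_reachable_of_leaf (kempeGraph_adj_le_two hφ δ η) hlx hly hlt hr h.symm
      hxy htx.symm).symm
  have hy : ¬ (kempeGraph (minusEdge G x y) φ δ η).Reachable t y := fun h =>
    hx (h.trans hr.symm)
  obtain ⟨ψ, hψ, h1, h2⟩ := exists_kempe_swap hφ (mem_missing.mp hδ).1 (mem_missing.mp hη).1 t
  refine ⟨ψ, hψ, fun v hv => h2 x v hv hx, fun v hv => h2 y v hv hy,
    fun v hv => h1 t v hv (SimpleGraph.Reachable.refl t), fun a b hab c hcδ hcη => ?_⟩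
  by_cases ha : (kempeGraph (minusEdge G x y) φ δ η).Reachable t a
  · rw [h1 a b hab ha, Equiv.swap_apply_eq_iff, Equiv.swap_apply_of_ne_of_ne hcδ hcη]
  · rw [h2 a b hab ha]

end

/-! ### Freeing colours and moving the uncoloured edge -/

section

variable [Fintype V] {G : SimpleGraph V} [DecidableRel G.Adj] {k : ℕ} {φ : Sym2 V → ℕ} {x y : V}

theorem not_light_of_adj (hG : ∀ ψ, ¬ IsEdgeColoring G k ψ) (hxy : G.Adj x y)
    (hφ : IsEdgeColoring (minusEdge G x y) k φ) : ¬ Light G k x y := by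
  intro h
  obtain ⟨c, _, hx, hy⟩ := exists_common_missing φ hxy h 0
  exact notMem_missing_of_mem_missing hG hφ hx hy

open Classical in
/-- A small colour `α` of `y` can be freed at `y`. -/
theorem exists_free_color (hG : ∀ ψ, ¬ IsEdgeColoring G k ψ) (hxy : G.Adj x y)
    (hφ : IsEdgeColoring (minusEdge G x y) k φ) {δ α : ℕ}
    (hδ : δ ∈ missing (minusEdge G x y) k φ y)
    (hα : IsSmallColor (minusEdge G x y) k φ (Light G k x) y α) (η₀ : ℕ) :
    ∃ ψ, IsEdgeColoring (minusEdge G x y) k ψ ∧ α ∈ missing (minusEdge G x y) k ψ y ∧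
      (∀ v, (minusEdge G x y).Adj x v → ψ s(x, v) = φ s(x, v)) ∧
      (∀ c, IsSmallColor (minusEdge G x y) k φ (Light G k x) y c →
        IsSmallColor (minusEdge G x y) k ψ (Light G k x) y c) ∧
      ∀ a b, (minusEdge G x y).Adj a b →
        (∀ c, c ≠ α → c ≠ δ → (c ∈ missing (minusEdge G x y) k φ x → c = η₀) →
          (ψ s(a, b) = c ↔ φ s(a, b) = c)) ∧
        (ψ s(a, b) = α → φ s(a, b) = α) ∧
        (φ s(a, b) = α → ψ s(a, b) = α ∨ (a = y ∨ b = y) ∧ ψ s(a, b) = δ) := by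
  rcases hα with hα | ⟨u, hu, rfl, hl⟩
  · exact ⟨φ, hφ, hα, fun _ _ => rfl, fun _ h => h,
      fun a b _ => ⟨fun _ _ _ _ => Iff.rfl, id, Or.inl⟩⟩
  have huG := minusEdge_adj_right.mp hu
  -- Only `δ` and `η` are swapped, so choosing `η ≠ η₀` protects one prescribed colour missing at
  -- `x`. Callers pass `0`, which is no colour, when none needs protection.
  obtain ⟨η, hη0, hηx, hηu⟩ := exists_common_missing φ hxy hl η₀
  obtain ⟨ψ, hψ, hψx, hψy, hψu, hψc⟩ := exists_swap_at hG hxy.ne hφ hηx hδ huG.2 huG.1.ne'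
    (Or.inr hηu)
  set H := minusEdge G x y with hH
  set α := φ s(y, u) with hαdef
  have hδ' := mem_missing.mp hδ
  have hηu' := mem_missing.mp hηu
  have hαδ : α ≠ δ := hδ'.2 u hu
  have hαη : α ≠ η := by
    have := hηu'.2 y hu.symm
    rwa [Sym2.eq_swap] at this
  have hψα : ∀ a b, H.Adj a b → (ψ s(a, b) = α ↔ φ s(a, b) = α) :=
    fun a b hab => hψc a b hab α hαδ hαη
  -- The swap turned the missing `η` at `u` into a missing `δ`, so `yu` can change from `α` to `δ`.
  have hup : IsEdgeColoring H k (Function.update ψ s(y, u) δ) := by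
    refine IsEdgeColoring.update (hψ.mono (SimpleGraph.deleteEdges_le _)) hδ'.1 ?_ ?_
    · intro v hv _
      rw [hψy v hv]
      exact hδ'.2 v hv
    · intro v hv _
      rw [hψu v hv, ne_eq, Equiv.swap_apply_eq_iff, Equiv.swap_apply_left]
      exact hηu'.2 v hv
  have hne : ∀ v, v ≠ u → s(y, v) ≠ s(y, u) := fun v hv e => hv (Sym2.congr_right.mp e)
  have hαm : α ∈ missing H k (Function.update ψ s(y, u) δ) y := by
    refine mem_missing.mpr ⟨hφ.mem_Icc hu, fun v hv => ?_⟩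
    by_cases hvu : v = u
    · rw [hvu, Function.update_self]; exact hαδ.symm
    · rw [Function.update_of_ne (hne v hvu), hψy v hv]
      exact fun e => hvu (hφ.inj hv hu e)
  refine ⟨Function.update ψ s(y, u) δ, hup, hαm, ?_, ?_, ?_⟩
  · intro v hv
    rw [Function.update_of_ne, hψx v hv]
    intro e
    rcases Sym2.eq_iff.mp e with h | h
    · exact hxy.ne h.1
    · exact huG.2 h.1.symm
  · intro c hc
    by_cases hcα : c = α
    · rw [hcα]; exact Or.inl hαm
    by_cases hcδ : c = δ
    · exact Or.inr ⟨u, hu, by rw [Function.update_self, hcδ], hl⟩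
    rcases hc with hc | ⟨v, hv, hvc, hvl⟩
    · rw [mem_missing] at hc
      refine Or.inl (mem_missing.mpr ⟨hc.1, fun v hv => ?_⟩)
      by_cases hvu : v = u
      · rw [hvu, Function.update_self]; exact Ne.symm hcδ
      · rw [Function.update_of_ne (hne v hvu), hψy v hv]
        exact hc.2 v hv
    · have hvu : v ≠ u := by
        rintro rfl
        exact hcα hvc.symm
      refine Or.inr ⟨v, hv, ?_, hvl⟩
      rw [Function.update_of_ne (hne v hvu), hψy v hv, hvc]
  · intro a b hab
    by_cases he : s(a, b) = s(y, u)
    · rw [he, Function.update_self, ← hαdef]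
      refine ⟨fun c h1 h2 _ => by simp [h1.symm, h2.symm], fun _ => rfl, fun _ => Or.inr ⟨?_, rfl⟩⟩
      rcases Sym2.eq_iff.mp he with h | h
      · exact Or.inl h.1
      · exact Or.inr h.2
    · rw [Function.update_of_ne he]
      refine ⟨fun c h1 h2 h3 => hψc a b hab c h2 fun e => ?_, (hψα a b hab).mp,
        fun h => Or.inl ((hψα a b hab).mpr h)⟩
      subst e
      exact hη0 (h3 hηx)

theorem notMem_missing_of_isSmallColor (hG : ∀ ψ, ¬ IsEdgeColoring G k ψ)
    (hd : ∀ v, G.degree v ≤ k) (hxy : G.Adj x y)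
    (hφ : IsEdgeColoring (minusEdge G x y) k φ) {α : ℕ}
    (hα : IsSmallColor (minusEdge G x y) k φ (Light G k x) y α) :
    α ∉ missing (minusEdge G x y) k φ x := by
  intro hx
  obtain ⟨δ, hδ⟩ := exists_mem_missing φ hxy.symm (hd y)
  rw [minusEdge_comm] at hδ
  obtain ⟨ψ, hψ, hy, hψx, -⟩ := exists_free_color hG hxy hφ hδ hα 0
  refine notMem_missing_of_mem_missing hG hψ ?_ hy
  rw [mem_missing] at hx ⊢
  exact ⟨hx.1, fun v hv => by rw [hψx v hv]; exact hx.2 v hv⟩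

open Classical in
/-- The uncoloured edge `xy` can be moved to `xz` if the colour of `xz` is a small colour of `y`. -/
theorem exists_dual (hG : ∀ ψ, ¬ IsEdgeColoring G k ψ) (hxy : G.Adj x y)
    (hφ : IsEdgeColoring (minusEdge G x y) k φ) {δ : ℕ}
    (hδ : δ ∈ missing (minusEdge G x y) k φ y) {z : V} (hz : (minusEdge G x y).Adj x z)
    {α : ℕ} (hzα : φ s(x, z) = α)
    (hα : IsSmallColor (minusEdge G x y) k φ (Light G k x) y α) (η₀ : ℕ) :
    ∃ ψ, IsEdgeColoring (minusEdge G x z) k ψ ∧ ψ s(x, y) = α ∧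
      α ∈ missing (minusEdge G x z) k ψ z ∧
      (∀ c, c ∈ missing (minusEdge G x z) k ψ x ↔ c ∈ missing (minusEdge G x y) k φ x) ∧
      (∀ c, c ≠ α → c ≠ δ → (c ∈ missing (minusEdge G x y) k φ x → c = η₀) → ∀ a b,
        ((minusEdge G x z).Adj a b ∧ ψ s(a, b) = c ↔
          (minusEdge G x y).Adj a b ∧ φ s(a, b) = c)) ∧
      (∀ a b, (minusEdge G x z).Adj a b → ψ s(a, b) = α → s(a, b) = s(x, y) ∨
        (minusEdge G x y).Adj a b ∧ φ s(a, b) = α) ∧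
      ∀ a b, (minusEdge G x y).Adj a b → φ s(a, b) = α → s(a, b) = s(x, z) ∨
        (minusEdge G x z).Adj a b ∧
          (ψ s(a, b) = α ∨ (a = y ∨ b = y) ∧ ψ s(a, b) = δ) := by
  obtain ⟨ψ, hψ, hαy, hψx, -, hψc⟩ := exists_free_color hG hxy hφ hδ hα η₀
  have hzG := minusEdge_adj_left.mp hz
  have hαy' := mem_missing.mp hαy
  have hyz : s(x, y) ≠ s(x, z) := fun e => hzG.2 (Sym2.congr_right.mp e).symm
  have hzψ : ψ s(x, z) = α := by rw [hψx z hz, hzα]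
  have hyadj : (minusEdge G x z).Adj x y := minusEdge_adj.mpr ⟨hxy, hyz⟩
  have hadj : ∀ a b, s(a, b) ≠ s(x, y) → s(a, b) ≠ s(x, z) →
      ((minusEdge G x z).Adj a b ↔ (minusEdge G x y).Adj a b) := by
    intro a b h1 h2
    simp [minusEdge_adj, h1, h2]
  have hle : minusEdge (minusEdge G x z) x y ≤ minusEdge G x y := by
    intro a b hab
    rw [minusEdge_adj, minusEdge_adj] at hab
    exact minusEdge_adj.mpr ⟨hab.1.1, hab.2⟩
  have hup : IsEdgeColoring (minusEdge G x z) k (Function.update ψ s(x, y) α) := by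
    refine IsEdgeColoring.update (hψ.mono hle) hαy'.1 ?_ ?_
    · intro v hv hvy e
      rw [minusEdge_adj_left] at hv
      refine hv.2 (hψ.inj (minusEdge_adj_left.mpr ⟨hv.1, hvy⟩) hz ?_)
      rw [e, hzψ]
    · intro v hv hvx
      exact hαy'.2 v (minusEdge_adj_right.mpr ⟨(minusEdge_adj.mp hv).1, hvx⟩)
  have hedge : ∀ a b, (minusEdge G x z).Adj a b → s(a, b) ≠ s(x, y) →
      (minusEdge G x y).Adj a b := fun a b hab hne =>
    (hadj a b hne (minusEdge_adj.mp hab).2).mp hab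
  have hcl : ∀ a b, (minusEdge G x z).Adj a b →
      Function.update ψ s(x, y) α s(a, b) = α → s(a, b) = s(x, y) ∨
        (minusEdge G x y).Adj a b ∧ φ s(a, b) = α := by
    intro a b hab h
    by_cases e : s(a, b) = s(x, y)
    · exact Or.inl e
    · rw [Function.update_of_ne e] at h
      exact Or.inr ⟨hedge a b hab e, ((hψc a b (hedge a b hab e)).2.1) h⟩
  refine ⟨Function.update ψ s(x, y) α, hup, Function.update_self _ _ _, ?_, ?_, ?_, hcl, ?_⟩
  · refine mem_missing.mpr ⟨hαy'.1, fun v hv h => ?_⟩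
    rcases hcl z v hv h with e | ⟨h1, h2⟩
    · rcases Sym2.eq_iff.mp e with h | h
      · exact hzG.1.ne h.1.symm
      · exact hzG.2 h.1
    · have : v = x := hφ.inj h1 hz.symm (by rw [h2, Sym2.eq_swap, hzα])
      exact (minusEdge_adj_right.mp hv).2 this
  · intro c
    -- At `x` the colour `α` merely passes from `xz` to `xy`.
    have key : ∀ c, (∃ v, (minusEdge G x z).Adj x v ∧ Function.update ψ s(x, y) α s(x, v) = c) ↔
        ∃ v, (minusEdge G x y).Adj x v ∧ φ s(x, v) = c := by
      intro c
      constructor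
      · rintro ⟨v, hv, h⟩
        by_cases e : v = y
        · rw [e, Function.update_self] at h
          exact ⟨z, hz, by rw [hzα, h]⟩
        · have e' : s(x, v) ≠ s(x, y) := fun h => e (Sym2.congr_right.mp h)
          rw [Function.update_of_ne e', hψx v (hedge x v hv e')] at h
          exact ⟨v, hedge x v hv e', h⟩
      · rintro ⟨v, hv, h⟩
        by_cases e : v = z
        · rw [e, hzα] at h
          exact ⟨y, hyadj, by rw [Function.update_self, h]⟩
        · have hv' := minusEdge_adj_left.mp hv
          refine ⟨v, minusEdge_adj_left.mpr ⟨hv'.1, e⟩, ?_⟩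
          rw [Function.update_of_ne (fun h => hv'.2 (Sym2.congr_right.mp h)), hψx v hv, h]
    simp only [missing, present, Set.mem_sdiff, Set.mem_ofPred_eq, key c]
  · intro c h1 h2 h3 a b
    by_cases e : s(a, b) = s(x, y)
    · rw [e, Function.update_self]
      simp [h1.symm, minusEdge_adj, e]
    by_cases e' : s(a, b) = s(x, z)
    · rw [e', hzα]
      simp [h1.symm, minusEdge_adj, e']
    rw [hadj a b e e', Function.update_of_ne e]
    exact and_congr_right fun hab => (hψc a b hab).1 c h1 h2 h3
  · intro a b hab h
    by_cases e' : s(a, b) = s(x, z)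
    · exact Or.inl e'
    have e := (minusEdge_adj.mp hab).2
    rw [Function.update_of_ne e]
    exact Or.inr ⟨(hadj a b e e').mpr hab, (hψc a b hab).2.2 h⟩

/-! ### Colours excluded by moving the uncoloured edge -/

/-- If the colour of `xz` is a small colour of `y`, no colour missing at `x` is small at `z`. -/
theorem not_isSmallColor_of_mem_missing_left (hG : ∀ ψ, ¬ IsEdgeColoring G k ψ)
    (hd : ∀ v, G.degree v ≤ k) (hxy : G.Adj x y)
    (hφ : IsEdgeColoring (minusEdge G x y) k φ) {z : V} (hz : (minusEdge G x y).Adj x z)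
    (hα : IsSmallColor (minusEdge G x y) k φ (Light G k x) y (φ s(x, z))) {γ : ℕ}
    (hγ : γ ∈ missing (minusEdge G x y) k φ x) :
    ¬ IsSmallColor (minusEdge G x y) k φ (Light G k x) z γ := by
  intro hs
  obtain ⟨δ, hδ⟩ := exists_mem_missing φ hxy.symm (hd y)
  rw [minusEdge_comm] at hδ
  -- Protecting `γ` keeps it small at `z` while `xz` becomes uncoloured; being missing at `x` too,
  -- it contradicts `notMem_missing_of_isSmallColor`.
  obtain ⟨ψ, hψ, -, -, hm, hc, -⟩ := exists_dual hG hxy hφ hδ hz rfl hα γ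
  have h1 : γ ≠ φ s(x, z) := ((mem_missing.mp hγ).2 z hz).symm
  have h2 : γ ≠ δ := by
    rintro rfl
    exact notMem_missing_of_mem_missing hG hφ hγ hδ
  exact notMem_missing_of_isSmallColor hG hd (minusEdge_adj.mp hz).1 hψ
    ((isSmallColor_congr fun u => hc γ h1 h2 (fun _ => rfl) z u).mpr hs) ((hm γ).mpr hγ)

/-- If the colour of `xz` is a small colour of `y`, no other colour missing at `y` is small
at `z`. -/
theorem not_isSmallColor_of_mem_missing_right (hG : ∀ ψ, ¬ IsEdgeColoring G k ψ)
    (hd : ∀ v, G.degree v ≤ k) (hxy : G.Adj x y)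
    (hφ : IsEdgeColoring (minusEdge G x y) k φ) {z : V} (hz : (minusEdge G x y).Adj x z)
    (hα : IsSmallColor (minusEdge G x y) k φ (Light G k x) y (φ s(x, z))) {δ : ℕ}
    (hδ : δ ∈ missing (minusEdge G x y) k φ y) (hne : φ s(x, z) ≠ δ) :
    ¬ IsSmallColor (minusEdge G x y) k φ (Light G k x) z δ := by
  have hzG := minusEdge_adj_left.mp hz
  have hδ' := mem_missing.mp hδ
  -- Trading `δ` for `η` on the chain at `t` leaves `x` and `y` alone, so the result for colours
  -- missing at `x` applies. Below, `t` is `z` itself or the light end of its `δ`-edge, and the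
  -- trade makes `η` small at `z`.
  have main : ∀ (t : V) (η : ℕ), t ≠ x → t ≠ y → η ∈ missing (minusEdge G x y) k φ x →
      (δ ∈ missing (minusEdge G x y) k φ t ∨ η ∈ missing (minusEdge G x y) k φ t) →
      ∃ ψ, IsEdgeColoring (minusEdge G x y) k ψ ∧
        (∀ v, (minusEdge G x y).Adj t v → ψ s(t, v) = Equiv.swap δ η (φ s(t, v))) ∧
        ¬ IsSmallColor (minusEdge G x y) k ψ (Light G k x) z η := by
    intro t η htx hty hη ht
    obtain ⟨ψ, hψ, hψx, hψy, hψt, -⟩ := exists_swap_at hG hxy.ne hφ hη hδ htx hty ht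
    refine ⟨ψ, hψ, hψt, not_isSmallColor_of_mem_missing_left hG hd hxy hψ hz ?_ ?_⟩
    · rw [hψx z hz]
      refine (isSmallColor_congr fun u => and_congr_right fun hu => ?_).mpr hα
      rw [hψy u hu]
    · refine (mem_missing_congr fun u => and_congr_right fun hu => ?_).mpr hη
      rw [hψx u hu]
  rintro (hs | ⟨v, hv, hvδ, hvl⟩)
  · obtain ⟨η, hη⟩ := exists_mem_missing φ hxy (hd x)
    obtain ⟨ψ, hψ, hψt, hn⟩ := main z η hzG.1.ne' hzG.2 hη (Or.inl hs)
    refine hn (Or.inl (mem_missing.mpr ⟨(mem_missing.mp hη).1, fun v hv e => ?_⟩))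
    rw [hψt v hv, Equiv.swap_apply_eq_iff, Equiv.swap_apply_right] at e
    exact (mem_missing.mp hs).2 v hv e
  · have hvx : v ≠ x := by
      rintro rfl
      rw [Sym2.eq_swap] at hvδ
      exact hne hvδ
    have hvy : v ≠ y := by
      rintro rfl
      rw [Sym2.eq_swap] at hvδ
      exact hδ'.2 z hv.symm hvδ
    obtain ⟨η, -, hηx, hηv⟩ := exists_common_missing φ hxy hvl 0
    obtain ⟨ψ, hψ, hψt, hn⟩ := main v η hvx hvy hηx (Or.inr hηv)
    refine hn (Or.inr ⟨v, hv, ?_, hvl⟩)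
    rw [Sym2.eq_swap, hψt z hv.symm, Sym2.eq_swap, hvδ, Equiv.swap_apply_left]

/-- Small colours of two neighbours of `x` that are joined to `y` by a chain of small colours. -/
theorem not_isSmallColor_of_chain (hG : ∀ ψ, ¬ IsEdgeColoring G k ψ)
    (hd : ∀ v, G.degree v ≤ k) (hxy : G.Adj x y)
    (hφ : IsEdgeColoring (minusEdge G x y) k φ) {z w z' w' : V} {α β β' : ℕ}
    (hz : (minusEdge G x y).Adj x z) (hzα : φ s(x, z) = α)
    (hα : IsSmallColor (minusEdge G x y) k φ (Light G k x) y α)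
    (hw : (minusEdge G x y).Adj x w) (hwβ : φ s(x, w) = β)
    (hβ : IsSmallColor (minusEdge G x y) k φ (Light G k x) z β)
    (hz' : (minusEdge G x y).Adj x z') (hzβ' : φ s(x, z') = β')
    (hw' : (minusEdge G x y).Adj w w') (hwβ' : φ s(w, w') = β') (hl : Light G k x w')
    (hβα : β ≠ α) (hβ'α : β' ≠ α) (hβ'β : β' ≠ β)
    (hβy : β ∉ missing (minusEdge G x y) k φ y) (hβ'y : β' ∉ missing (minusEdge G x y) k φ y) :
    ¬ IsSmallColor (minusEdge G x y) k φ (Light G k x) z' β := by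
  intro hs
  obtain ⟨δ, hδ⟩ := exists_mem_missing φ hxy.symm (hd y)
  rw [minusEdge_comm] at hδ
  have hβx : β ∉ missing (minusEdge G x y) k φ x := fun h => (mem_missing.mp h).2 w hw hwβ
  have hβ'x : β' ∉ missing (minusEdge G x y) k φ x := fun h => (mem_missing.mp h).2 z' hz' hzβ'
  obtain ⟨φ₁, hφ₁, -, hα₁, hm₁, hc₁, -⟩ := exists_dual hG hxy hφ hδ hz hzα hα 0
  have hcβ := hc₁ β hβα (by rintro rfl; exact hβy hδ) (fun h => absurd h hβx)
  have hcβ' := hc₁ β' hβ'α (by rintro rfl; exact hβ'y hδ) (fun h => absurd h hβ'x)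
  obtain ⟨hw₁, hwβ₁⟩ := (hcβ x w).mpr ⟨hw, hwβ⟩
  have hs₁ := (isSmallColor_congr (k := k) (P := Light G k x) (hcβ z')).mpr hs
  have hβ₁ := (isSmallColor_congr (k := k) (P := Light G k x) (hcβ z)).mpr hβ
  -- The second move, from `xz` to `xw`, uses the `α` just freed at `z` in the role of `δ`.
  obtain ⟨φ₂, hφ₂, hzβ₂, hβ₂, -, hc₂, hb₂, hb₂'⟩ :=
    exists_dual hG (minusEdge_adj.mp hz).1 hφ₁ hα₁ hw₁ hwβ₁ hβ₁ 0
  have hcβ'₂ := hc₂ β' hβ'β hβ'α (fun h => absurd ((hm₁ _).mp h) hβ'x)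
  obtain ⟨hz'₂, hzβ'₂⟩ := (hcβ'₂ x z').mpr ((hcβ' x z').mpr ⟨hz', hzβ'⟩)
  obtain ⟨hw'₂, hwβ'₂⟩ := (hcβ'₂ w w').mpr ((hcβ' w w').mpr ⟨hw', hwβ'⟩)
  have hz'x : z' ≠ x := hz'.ne'
  have hz'z : z' ≠ z := by
    rintro rfl
    exact hβ'α (hzβ'.symm.trans hzα)
  have hz'w : z' ≠ w := by
    rintro rfl
    exact hβ'β (hzβ'.symm.trans hwβ)
  refine not_isSmallColor_of_mem_missing_right hG hd (minusEdge_adj.mp hw).1 hφ₂ hz'₂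
    (Or.inr ⟨w', hw'₂, by rw [hwβ'₂, hzβ'₂], hl⟩) hβ₂ (by rwa [hzβ'₂]) ?_
  have hne : ∀ u v, v ≠ z' → s(z', u) ≠ s(x, v) := by
    intro u v hv e
    rcases Sym2.eq_iff.mp e with h | h
    · exact hz'x h.1
    · exact hv h.1.symm
  -- Smallness of `β` at `z'` survives the second move: a `β`-edge at `z'` can change only if it is
  -- `z'z`, and then it turns to `α`, leaving `β` missing at `z'`.
  rcases hs₁ with hs₁ | ⟨u, hu, huβ, hul⟩
  · refine Or.inl (mem_missing.mpr ⟨(mem_missing.mp hs₁).1, fun v hv e => ?_⟩)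
    rcases hb₂ z' v hv e with h | ⟨h, h'⟩
    · exact hne v z hz'z.symm h
    · exact (mem_missing.mp hs₁).2 v h h'
  · rcases hb₂' z' u hu huβ with h | ⟨hu₂, h | ⟨-, h⟩⟩
    · exact absurd h (hne u w hz'w.symm)
    · exact Or.inr ⟨u, hu₂, h, hul⟩
    · refine Or.inl (mem_missing.mpr ⟨(mem_missing.mp hβ₂).1, fun v hv e => ?_⟩)
      rcases hb₂ z' v hv e with h' | ⟨h', h''⟩
      · exact hne v z hz'z.symm h'
      · have : v = u := hφ₁.inj h' hu (by rw [h'', huβ])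
        rw [this, h] at e
        exact hβα e.symm

/-- A colour missing at `x` is not the colour of an edge from `w` to a light vertex. -/
theorem notMem_missing_left_of_light (hG : ∀ ψ, ¬ IsEdgeColoring G k ψ)
    (hd : ∀ v, G.degree v ≤ k) (hxy : G.Adj x y)
    (hφ : IsEdgeColoring (minusEdge G x y) k φ) {z w u : V} {α β γ : ℕ}
    (hz : (minusEdge G x y).Adj x z) (hzα : φ s(x, z) = α)
    (hα : IsSmallColor (minusEdge G x y) k φ (Light G k x) y α)
    (hw : (minusEdge G x y).Adj x w) (hwβ : φ s(x, w) = β)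
    (hβ : IsSmallColor (minusEdge G x y) k φ (Light G k x) z β)
    (hβα : β ≠ α) (hβy : β ∉ missing (minusEdge G x y) k φ y)
    (hu : (minusEdge G x y).Adj w u) (huγ : φ s(w, u) = γ) (hl : Light G k x u) :
    γ ∉ missing (minusEdge G x y) k φ x := by
  intro hγ
  obtain ⟨δ, hδ⟩ := exists_mem_missing φ hxy.symm (hd y)
  rw [minusEdge_comm] at hδ
  have hβx : β ∉ missing (minusEdge G x y) k φ x := fun h => (mem_missing.mp h).2 w hw hwβ
  obtain ⟨φ₁, hφ₁, -, hα₁, hm₁, hc₁, -⟩ := exists_dual hG hxy hφ hδ hz hzα hα γ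
  have hcβ := hc₁ β hβα (by rintro rfl; exact hβy hδ) (fun h => absurd h hβx)
  have hcγ := hc₁ γ (by rintro rfl; exact (mem_missing.mp hγ).2 z hz hzα)
    (by rintro rfl; exact notMem_missing_of_mem_missing hG hφ hγ hδ) (fun _ => rfl)
  obtain ⟨hw₁, hwβ₁⟩ := (hcβ x w).mpr ⟨hw, hwβ⟩
  obtain ⟨hu₁, huγ₁⟩ := (hcγ w u).mpr ⟨hu, huγ⟩
  refine not_isSmallColor_of_mem_missing_left hG hd (minusEdge_adj.mp hz).1 hφ₁ hw₁ ?_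
    ((hm₁ γ).mpr hγ) (Or.inr ⟨u, hu₁, huγ₁, hl⟩)
  rw [hwβ₁]
  exact (isSmallColor_congr (hcβ z)).mpr hβ

/-- A colour missing at `y` is not the colour of an edge from `w` to a light vertex. -/
theorem notMem_missing_right_of_light (hG : ∀ ψ, ¬ IsEdgeColoring G k ψ)
    (hd : ∀ v, G.degree v ≤ k) (hxy : G.Adj x y)
    (hφ : IsEdgeColoring (minusEdge G x y) k φ) {z w u : V} {α β γ : ℕ}
    (hz : (minusEdge G x y).Adj x z) (hzα : φ s(x, z) = α)
    (hα : IsSmallColor (minusEdge G x y) k φ (Light G k x) y α)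
    (hw : (minusEdge G x y).Adj x w) (hwβ : φ s(x, w) = β)
    (hβ : IsSmallColor (minusEdge G x y) k φ (Light G k x) z β)
    (hβα : β ≠ α) (hβy : β ∉ missing (minusEdge G x y) k φ y)
    (hu : (minusEdge G x y).Adj w u) (huγ : φ s(w, u) = γ) (hl : Light G k x u) (hux : u ≠ x) :
    γ ∉ missing (minusEdge G x y) k φ y := by
  intro hγ
  have hβx : β ∉ missing (minusEdge G x y) k φ x := fun h => (mem_missing.mp h).2 w hw hwβ
  have hwG := minusEdge_adj_left.mp hw
  have huy : u ≠ y := by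
    rintro rfl
    exact not_light_of_adj hG hxy hφ hl
  -- If `γ = α`, moving to `xz` keeps `α` on `wu` and makes it missing at `z`. Otherwise a swap at
  -- `u` gives `wu` a colour missing at `x`, the case already excluded.
  by_cases hγα : γ = α
  · subst hγα
    obtain ⟨φ₁, hφ₁, -, hα₁, hm₁, hc₁, -, hb₁⟩ := exists_dual hG hxy hφ hγ hz hzα hα 0
    have hcβ := hc₁ β hβα hβα (fun h => absurd h hβx)
    obtain ⟨hw₁, hwβ₁⟩ := (hcβ x w).mpr ⟨hw, hwβ⟩
    refine not_isSmallColor_of_mem_missing_right hG hd (minusEdge_adj.mp hz).1 hφ₁ hw₁ ?_ hα₁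
      (by rwa [hwβ₁]) ?_
    · rw [hwβ₁]
      exact (isSmallColor_congr (hcβ z)).mpr hβ
    · rcases hb₁ w u hu huγ with h | ⟨hu₁, h⟩
      · rcases Sym2.eq_iff.mp h with h | h
        · exact absurd h.1 hw.ne'
        · exact absurd h.2 hux
      · refine Or.inr ⟨u, hu₁, ?_, hl⟩
        rcases h with h | h
        · exact h
        · exact h.2
  · obtain ⟨η, -, hηx, hηu⟩ := exists_common_missing φ hxy hl 0
    obtain ⟨ψ, hψ, hψx, hψy, hψu, hψc⟩ := exists_swap_at hG hxy.ne hφ hηx hγ hux huy (Or.inr hηu)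
    have hcβ := fun a b hab => hψc a b hab β (by rintro rfl; exact hβy hγ)
      (by rintro rfl; exact hβx hηx)
    have hy : ∀ c u, ((minusEdge G x y).Adj y u ∧ ψ s(y, u) = c) ↔
        ((minusEdge G x y).Adj y u ∧ φ s(y, u) = c) :=
      fun c u => and_congr_right fun hu => by rw [hψy u hu]
    refine notMem_missing_left_of_light hG hd hxy hψ hz ((hψx z hz).trans hzα)
      ((isSmallColor_congr (hy α)).mpr hα) hw ((hψx w hw).trans hwβ)
      ((isSmallColor_congr fun v => and_congr_right (hcβ z v)).mpr hβ) hβα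
      (fun h => hβy ((mem_missing_congr (hy β)).mp h)) hu (γ := η) ?_ hl ?_
    · rw [Sym2.eq_swap, hψu w hu.symm, Sym2.eq_swap, huγ, Equiv.swap_apply_left]
    · exact (mem_missing_congr fun v => and_congr_right fun hv => by rw [hψx v hv]).mpr hηx

/-- A small colour of `y` is not the colour of an edge from `w` to a light vertex. -/
theorem not_isSmallColor_of_light (hG : ∀ ψ, ¬ IsEdgeColoring G k ψ)
    (hd : ∀ v, G.degree v ≤ k) (hxy : G.Adj x y)
    (hφ : IsEdgeColoring (minusEdge G x y) k φ) {z w u : V} {α β γ : ℕ}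
    (hz : (minusEdge G x y).Adj x z) (hzα : φ s(x, z) = α)
    (hα : IsSmallColor (minusEdge G x y) k φ (Light G k x) y α)
    (hw : (minusEdge G x y).Adj x w) (hwβ : φ s(x, w) = β)
    (hβ : IsSmallColor (minusEdge G x y) k φ (Light G k x) z β)
    (hβα : β ≠ α) (hβy : β ∉ missing (minusEdge G x y) k φ y)
    (hu : (minusEdge G x y).Adj w u) (huγ : φ s(w, u) = γ) (hl : Light G k x u) (hux : u ≠ x) :
    ¬ IsSmallColor (minusEdge G x y) k φ (Light G k x) y γ := by
  intro hγ
  obtain ⟨δ, hδ⟩ := exists_mem_missing φ hxy.symm (hd y)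
  rw [minusEdge_comm] at hδ
  have hβx : β ∉ missing (minusEdge G x y) k φ x := fun h => (mem_missing.mp h).2 w hw hwβ
  have hβγ : β ≠ γ := by
    rintro rfl
    exact hux (hφ.inj hu hw.symm (by rw [huγ, Sym2.eq_swap, hwβ]))
  -- Freeing `γ` at `y` reduces to a colour missing at `y`; the edge `wu` keeps `γ` because only an
  -- edge at `y` can lose it.
  obtain ⟨ψ, hψ, hγy, hψx, hψs, hψc⟩ := exists_free_color hG hxy hφ hδ hγ 0
  have hcβ := fun a b hab => (hψc a b hab).1 β hβγ (by rintro rfl; exact hβy hδ)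
    (fun h => absurd h hβx)
  refine notMem_missing_right_of_light hG hd hxy hψ hz ((hψx z hz).trans hzα) (hψs α hα) hw
    ((hψx w hw).trans hwβ) ((isSmallColor_congr fun v => and_congr_right (hcβ z v)).mpr hβ) hβα
    (fun h => hβy ((mem_missing_congr fun v => and_congr_right (hcβ y v)).mp h)) hu (γ := γ) ?_ hl
    hux hγy
  rcases (hψc w u hu).2.2 huγ with h | ⟨h | h, -⟩
  · exact h
  · exact absurd h (minusEdge_adj_left.mp hw).2
  · subst h
    exact absurd hl (not_light_of_adj hG hxy hφ)

end

end EdgeCritical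

/-! ### Translation to the sets `A`, `B` and `M` -/

namespace EdgeCritical

variable {V : Type*} [Fintype V] {G : SimpleGraph V} [DecidableRel G.Adj] {φ : Sym2 V → ℕ}
  {x y : V} {q : ℝ}

theorem IsDeltaCritical.not_isEdgeColoring (hG : IsDeltaCritical G) (ψ : Sym2 V → ℕ) :
    ¬ IsEdgeColoring G G.maxDegree ψ := by
  intro h
  have h1 : chromaticIndex G ≤ G.maxDegree := Nat.sInf_le ⟨ψ, h⟩
  have h2 := hG.1
  omega

theorem notMem_setM_of_mem_setB (hφ : IsEdgeColoring (minusEdge G x y) G.maxDegree φ) {β : ℕ}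
    (hβ : β ∈ setB G φ x y q) : β ∉ setM G φ x y q := by
  obtain ⟨⟨v, hv, hvβ⟩, u, hu, huβ, huq⟩ := hβ
  rintro ((⟨-, u', hu', hu'β, hu'q⟩ | h) | h)
  · have := hφ.inj hu hu' (huβ.trans hu'β.symm)
    subst this
    exact absurd hu'q huq.not_gt
  · exact (mem_missing.mp h).2 v hv hvβ
  · exact (mem_missing.mp h).2 u hu huβ

theorem isSmallColor_of_mem_smallSet (hq : ∀ u, (G.degree u : ℝ) < q → Light G G.maxDegree x u)
    {v : V} {c : ℕ} (h : c ∈ smallSet G φ x y q v) :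
    IsSmallColor (minusEdge G x y) G.maxDegree φ (Light G G.maxDegree x) v c :=
  h.2.imp id fun ⟨u, hu, huc, hl⟩ => ⟨u, hu, huc, hq u hl⟩

/-- The colour of `xz` is present at `x`, so its membership in `M` comes from `A` or from being
missing at `y`. -/
theorem isSmallColor_of_mem_nbr (hq : ∀ u, (G.degree u : ℝ) < q → Light G G.maxDegree x u)
    {z : V} (hz : z ∈ nbr G φ x y (setM G φ x y q)) :
    IsSmallColor (minusEdge G x y) G.maxDegree φ (Light G G.maxDegree x) y (φ s(x, z)) := by
  obtain ⟨hz, (⟨-, u, hu, huc, hl⟩ | h) | h⟩ := hz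
  · exact Or.inr ⟨u, hu, huc, hq u hl⟩
  · exact absurd rfl ((mem_missing.mp h).2 z hz)
  · exact Or.inl h

theorem exists_adj_of_mem_setBw (hG : IsDeltaCritical G) (hxy : G.Adj x y)
    (hq : ∀ u, (G.degree u : ℝ) < q → Light G G.maxDegree x u)
    (hφ : IsEdgeColoring (minusEdge G x y) G.maxDegree φ) {z w : V} {β β' : ℕ}
    (hz : z ∈ nbr G φ x y (setM G φ x y q)) (hβ : β ∈ smallSet G φ x y q z ∩ setB G φ x y q)
    (hw : w ∈ nbr G φ x y (setB G φ x y q)) (hwβ : φ s(x, w) = β)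
    (hβ' : β' ∈ setBw G φ x y q β w) :
    ∃ z' ∈ nbr G φ x y (setB G φ x y q), ∃ u, (minusEdge G x y).Adj z' u ∧
      φ s(x, z') = β' ∧ φ s(z', u) = β ∧ q ≤ (G.degree u : ℝ) := by
  obtain ⟨w', hw', hwβ', ⟨hβ'B, hβ'β⟩, hl⟩ := hβ'
  obtain ⟨z', hz', hzβ'⟩ := hβ'B.1
  have hβM := notMem_setM_of_mem_setB hφ hβ.2
  have hβ'M := notMem_setM_of_mem_setB hφ hβ'B
  have hs := not_isSmallColor_of_chain hG.not_isEdgeColoring G.degree_le_maxDegree hxy hφ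
    hz.1 rfl (isSmallColor_of_mem_nbr hq hz) hw.1 hwβ (isSmallColor_of_mem_smallSet hq hβ.1)
    hz' hzβ' hw' hwβ' (hq w' hl) (fun e => hβM (e ▸ hz.2)) (fun e => hβ'M (e ▸ hz.2)) hβ'β
    (fun h => hβM (Or.inr h)) (fun h => hβ'M (Or.inr h))
  refine ⟨z', ⟨hz', by rwa [hzβ']⟩, ?_⟩
  have hm : β ∉ missing (minusEdge G x y) G.maxDegree φ z' := fun h => hs (Or.inl h)
  rw [mem_missing] at hm
  push Not at hm
  obtain ⟨u, hu, huβ⟩ := hm hβ.1.1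
  refine ⟨u, hu, hzβ', huβ, ?_⟩
  by_contra! hlt
  exact hs (Or.inr ⟨u, hu, huβ, hq u hlt⟩)

/-- The colour is neither missing at `x` nor small at `y`, which is exactly what puts it in `B`. -/
theorem mem_setB_of_degree_lt (hG : IsDeltaCritical G) (hxy : G.Adj x y)
    (hq : ∀ u, (G.degree u : ℝ) < q → Light G G.maxDegree x u)
    (hφ : IsEdgeColoring (minusEdge G x y) G.maxDegree φ) {z w u : V} {β : ℕ}
    (hz : z ∈ nbr G φ x y (setM G φ x y q)) (hβ : β ∈ smallSet G φ x y q z ∩ setB G φ x y q)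
    (hw : (minusEdge G x y).Adj x w) (hwβ : φ s(x, w) = β)
    (hu : (minusEdge G x y).Adj w u) (hux : u ≠ x) (hl : (G.degree u : ℝ) < q) :
    φ s(w, u) ∈ setB G φ x y q := by
  have hβM := notMem_setM_of_mem_setB hφ hβ.2
  have hβα : β ≠ φ s(x, z) := fun e => hβM (e ▸ hz.2)
  have hβy : β ∉ missing (minusEdge G x y) G.maxDegree φ y := fun h => hβM (Or.inr h)
  have h1 := notMem_missing_left_of_light hG.not_isEdgeColoring G.degree_le_maxDegree hxy hφ
    hz.1 rfl (isSmallColor_of_mem_nbr hq hz) hw hwβ (isSmallColor_of_mem_smallSet hq hβ.1)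
    hβα hβy hu rfl (hq u hl)
  have h2 := not_isSmallColor_of_light hG.not_isEdgeColoring G.degree_le_maxDegree hxy hφ
    hz.1 rfl (isSmallColor_of_mem_nbr hq hz) hw hwβ (isSmallColor_of_mem_smallSet hq hβ.1)
    hβα hβy hu rfl (hq u hl) hux
  have hI := hφ.mem_Icc hu
  rw [IsSmallColor, not_or] at h2
  have h3 := h2.1
  rw [mem_missing] at h1 h3
  push Not at h1 h3
  obtain ⟨v, hv, hvc⟩ := h3 hI
  refine ⟨h1 hI, v, hv, hvc, ?_⟩
  by_contra! hlt
  exact h2.2 ⟨v, hv, hvc, hq v hlt⟩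

end EdgeCritical

theorem mainTheorem3 {V : Type*} [Fintype V] (G : SimpleGraph V) [DecidableRel G.Adj]
    (hG : EdgeCritical.IsDeltaCritical G)
    (ε : ℝ) (hε0 : 0 < ε) (hε1 : ε < 1) (q : ℝ) (hq : q = (1 - ε) * (G.maxDegree : ℝ))
    (x y : V) (hxy : G.Adj x y) (hx : (G.degree x : ℝ) < ε * (G.maxDegree : ℝ))
    (φ : Sym2 V → ℕ)
    (hφ : EdgeCritical.IsEdgeColoring (EdgeCritical.minusEdge G x y) G.maxDegree φ) :
    (∀ z ∈ EdgeCritical.nbr G φ x y (EdgeCritical.setM G φ x y q),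
      ∀ β ∈ EdgeCritical.smallSet G φ x y q z ∩ EdgeCritical.setB G φ x y q,
      ∀ w ∈ EdgeCritical.nbr G φ x y (EdgeCritical.setB G φ x y q), φ s(x, w) = β →
      ∀ β' ∈ EdgeCritical.setBw G φ x y q β w,
        ∃ z' ∈ EdgeCritical.nbr G φ x y (EdgeCritical.setB G φ x y q),
          ∃ u, (EdgeCritical.minusEdge G x y).Adj z' u ∧
            φ s(x, z') = β' ∧ φ s(z', u) = β ∧ q ≤ (G.degree u : ℝ)) ∧
    ((⋃ z ∈ EdgeCritical.nbr G φ x y (EdgeCritical.setM G φ x y q),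
          EdgeCritical.smallSet G φ x y q z) ∩ EdgeCritical.setB G φ x y q
        = EdgeCritical.setB G φ x y q →
      (EdgeCritical.setB G φ x y q).ncard = 2 →
        ∃ z' ∈ EdgeCritical.nbr G φ x y (EdgeCritical.setB G φ x y q),
          ∀ u, G.Adj z' u → u ≠ x → q ≤ (G.degree u : ℝ)) := by
  have hlight : ∀ u, (G.degree u : ℝ) < q → EdgeCritical.Light G G.maxDegree x u := by
    intro u hu
    have : ((G.degree u + G.degree x : ℕ) : ℝ) < (G.maxDegree : ℝ) := by
      push_cast
      linarith
    exact_mod_cast this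
  refine ⟨fun z hz β hβ w hw hwβ β' hβ' =>
    EdgeCritical.exists_adj_of_mem_setBw hG hxy hlight hφ hz hβ hw hwβ hβ', ?_⟩
  intro hU hcard
  obtain ⟨β₁, β₂, hne, hB⟩ := Set.ncard_eq_two.mp hcard
  have hmem : ∀ β ∈ EdgeCritical.setB G φ x y q,
      ∃ z ∈ EdgeCritical.nbr G φ x y (EdgeCritical.setM G φ x y q),
        β ∈ EdgeCritical.smallSet G φ x y q z ∩ EdgeCritical.setB G φ x y q := by
    intro β hβ
    have h := hβ
    rw [← hU] at h
    obtain ⟨z, hz, hzβ⟩ := Set.mem_iUnion₂.mp h.1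
    exact ⟨z, hz, hzβ, hβ⟩
  have hβ₁ : β₁ ∈ EdgeCritical.setB G φ x y q := by rw [hB]; simp
  have hβ₂ : β₂ ∈ EdgeCritical.setB G φ x y q := by rw [hB]; simp
  by_contra! hcon
  -- The colour of `wu` differs from `β` because the `β`-edge at `w` is `wx`; with `|B| = 2` it must
  -- be the other colour of `B`.
  have key : ∀ β ∈ EdgeCritical.setB G φ x y q, ∃ w u, (EdgeCritical.minusEdge G x y).Adj x w ∧
      φ s(x, w) = β ∧ (EdgeCritical.minusEdge G x y).Adj w u ∧
      φ s(w, u) ∈ EdgeCritical.setB G φ x y q ∧ φ s(w, u) ≠ β ∧ (G.degree u : ℝ) < q := by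
    intro β hβ
    obtain ⟨w, hw, hwβ⟩ := hβ.1
    obtain ⟨u, hu, hux, huq⟩ := hcon w ⟨hw, by rwa [hwβ]⟩
    obtain ⟨z, hz, hzβ⟩ := hmem β hβ
    have hwy := (EdgeCritical.minusEdge_adj_left.mp hw).2
    have hu' := (EdgeCritical.minusEdge_adj_of_ne hw.ne' hwy).mpr hu
    refine ⟨w, u, hw, hwβ, hu', EdgeCritical.mem_setB_of_degree_lt hG hxy hlight hφ hz hzβ hw hwβ
      hu' hux huq, fun e => hux (hφ.inj hu' hw.symm ?_), huq⟩
    rw [e, Sym2.eq_swap, hwβ]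
  obtain ⟨w₁, u₁, hw₁, hwβ₁, hu₁, hc₁, hn₁, hq₁⟩ := key β₁ hβ₁
  obtain ⟨w₂, u₂, hw₂, hwβ₂, hu₂, hc₂, hn₂, hq₂⟩ := key β₂ hβ₂
  have e₁ : φ s(w₁, u₁) = β₂ := by
    rw [hB] at hc₁
    exact hc₁.resolve_left hn₁
  have e₂ : φ s(w₂, u₂) = β₁ := by
    rw [hB] at hc₂
    exact hc₂.resolve_right hn₂
  obtain ⟨z, hz, hzβ⟩ := hmem β₁ hβ₁
  -- Part (1) for `β₁` and `β₂` makes the `β₁`-edge at `w₂` end in a vertex of degree at least `q`;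
  -- that end is `u₂`.
  obtain ⟨z', hz', u, hu, hzβ', huβ, hqu⟩ := EdgeCritical.exists_adj_of_mem_setBw hG hxy hlight hφ
    hz hzβ ⟨hw₁, by rwa [hwβ₁]⟩ hwβ₁ (β' := β₂)
    ⟨u₁, hu₁, e₁, ⟨hβ₂, fun h => hne h.symm⟩, hq₁⟩
  have hzw : z' = w₂ := hφ.inj hz'.1 hw₂ (hzβ'.trans hwβ₂.symm)
  subst hzw
  have huu : u = u₂ := hφ.inj hu hu₂ (huβ.trans e₂.symm)
  subst huu
  exact absurd hq₂ hqu.not_gt
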